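/- Let $p$ be a prime and let $n\ge 2$ be an integer. For $a=(a_0,\dots,a_n)\in\mathbb{Z}_p^{n+1}$ let $X_a\subset\mathbb{P}^n$ be the diagonal cubic hypersurface $\sum_{i=0}^n a_i x_i^3=0$ over $\mathbb{Q}_p$, and put $$\rho_p(n,3)=\mu_p\bigl(\{a\in\mathbb{Z}_p^{n+1} : X_a(\mathbb{Q}_p)\neq\emptyset\}\bigr),$$ where $\mu_p$ is the product on $\mathbb{Z}_p^{n+1}$ of the Haar measures on $\mathbb{Z}_p$ normalized so that $\mathbb{Z}_p$ has measure $1$. Then: 1. $\rho_p(2,3)=\begin{cases}\dfrac{13831}{19773} & \text{if } p=3,\\ 1-2p^{-1}\left(\dfrac{1-p^{-1}}{1-p^{-3}}\right) & \text{if } p\equiv 1 \bmod 3,\\ 1-6p^{-3}\left(\dfrac{1-p^{-1}}{1-p^{-3}}\right)^{3} & \text{if } p\equiv 2 \bmod 3.\end{cases}$ 2. $\rho_p(3,3)=\begin{cases}\dfrac{6391}{6591} & \text{if } p=3,\\ 1-\dfrac{8}{3}p^{-2}(1+p^{-1})^{2}\left(\dfrac{1-p^{-1}}{1-p^{-3}}\right)^{3}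 & \text{if } p\equiv 1 \bmod 3,\\ 1 & \text{if } p\equiv 2 \bmod 3.\end{cases}$ 3. $\rho_p(4,3)=\begin{cases}1-\dfrac{40}{3}p^{-4}\left(\dfrac{1-p^{-1}}{1-p^{-3}}\right)^{4} & \text{if } p\equiv 1 \bmod 3,\\ 1 & \text{otherwise.}\end{cases}$ 4. $\rho_p(5,3)=\begin{cases}1-\dfrac{80}{3}p^{-6}\left(\dfrac{1-p^{-1}}{1-p^{-3}}\right)^{6} & \text{if } p\equiv 1 \bmod 3,\\ 1 & \text{otherwise.}\end{cases}$ 5. If $n\ge 6$, then $\rho_p(n,3)=1$. -/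

import Mathlib

open MeasureTheory
open scoped LinearAlgebra.Projectivization

/-- The set `X_a^k(K)` of `K`-rational points of the diagonal hypersurface
`a 0 * x 0 ^ k + ⋯ + a n * x n ^ k = 0` in the projective space `ℙ^n` over `K`. -/
def diagonalPoints {K : Type*} [Field K] (n k : ℕ) (a : Fin (n + 1) → K) :
    Set (ℙ K (Fin (n + 1) → K)) :=
  {P | ∑ i, a i * P.rep i ^ k = 0}

/-- The condition does not depend on the choice of homogeneous coordinates. -/
theorem mk_mem_diagonalPoints {K : Type*} [Field K] (n k : ℕ) (a : Fin (n + 1) → K)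
    (x : Fin (n + 1) → K) (hx : x ≠ 0) :
    Projectivization.mk K x hx ∈ diagonalPoints n k a ↔ ∑ i, a i * x i ^ k = 0 := by
  obtain ⟨c, hc⟩ := Projectivization.exists_smul_eq_mk_rep K x hx
  have h : ∑ i, a i * (Projectivization.mk K x hx).rep i ^ k
      = (c : K) ^ k * ∑ i, a i * x i ^ k := by
    rw [← hc, Finset.mul_sum]
    refine Finset.sum_congr rfl fun i _ => ?_
    simp only [Pi.smul_apply, Units.smul_def, smul_eq_mul]
    ring
  simp [diagonalPoints, h]

/-- There is a rational point iff the equation has a nonzero solution. -/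
theorem diagonalPoints_nonempty_iff {K : Type*} [Field K] (n k : ℕ) (a : Fin (n + 1) → K) :
    (diagonalPoints n k a).Nonempty ↔ ∃ x : Fin (n + 1) → K, x ≠ 0 ∧ ∑ i, a i * x i ^ k = 0 := by
  constructor
  · rintro ⟨P, hP⟩
    exact ⟨P.rep, P.rep_nonzero, hP⟩
  · rintro ⟨x, hx, h⟩
    exact ⟨Projectivization.mk K x hx, (mk_mem_diagonalPoints n k a x hx).2 h⟩

/-- `ℤ_p` carries its Borel σ-algebra. -/
noncomputable instance padicIntMeasurableSpace (p : ℕ) [Fact p.Prime] : MeasurableSpace ℤ_[p] := borel _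

instance padicIntBorelSpace (p : ℕ) [Fact p.Prime] : BorelSpace ℤ_[p] := ⟨rfl⟩

/-- The Haar measure `μ_p` on `ℤ_p`, normalized so that `μ_p(ℤ_p) = 1`. -/
noncomputable def padicHaar (p : ℕ) [Fact p.Prime] : Measure ℤ_[p] :=
  Measure.addHaarMeasure (⊤ : TopologicalSpace.PositiveCompacts ℤ_[p])

instance padicHaar_isProbabilityMeasure (p : ℕ) [Fact p.Prime] :
    IsProbabilityMeasure (padicHaar p) :=
  ⟨Measure.addHaarMeasure_self (K₀ := (⊤ : TopologicalSpace.PositiveCompacts ℤ_[p]))⟩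

/-- The set of `a ∈ ℤ_p^{n+1}` such that `X_a^k(ℚ_p) ≠ ∅`. -/
def solubleSet (p : ℕ) [Fact p.Prime] (n k : ℕ) : Set (Fin (n + 1) → ℤ_[p]) :=
  {a | (diagonalPoints n k (fun i => (a i : ℚ_[p]))).Nonempty}

/-- The soluble set is closed, so its measure below is that of a Borel set. -/
theorem isClosed_solubleSet (p : ℕ) [Fact p.Prime] (n k : ℕ) : IsClosed (solubleSet p n k) := by
  have key : solubleSet p n k = Prod.fst ''
      {q : (Fin (n + 1) → ℤ_[p]) × (Fin (n + 1) → ℤ_[p]) |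
        (∃ i, q.2 i = 1) ∧ ∑ i, q.1 i * q.2 i ^ k = 0} := by
    ext a
    simp only [solubleSet, Set.mem_ofPred_eq, diagonalPoints_nonempty_iff, Set.mem_image,
      Prod.exists, exists_and_right, exists_eq_right]
    have hcast (y : Fin (n + 1) → ℤ_[p]) :
        ((∑ i, a i * y i ^ k : ℤ_[p]) : ℚ_[p]) = ∑ i, (a i : ℚ_[p]) * (y i : ℚ_[p]) ^ k := by
      change PadicInt.Coe.ringHom (∑ i, a i * y i ^ k) = _
      simp only [map_sum, map_mul, map_pow]
      rfl
    constructor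
    · rintro ⟨x, hx, h⟩
      obtain ⟨j, -, hj⟩ := Finset.exists_max_image Finset.univ (fun i => ‖x i‖) ⟨0, by simp⟩
      have hj0 : x j ≠ 0 := by
        intro h0
        refine hx (funext fun i => ?_)
        have := hj i (Finset.mem_univ i)
        rw [h0, norm_zero] at this
        simpa using this
      have hy (i : Fin (n + 1)) : ∃ y : ℤ_[p], (y : ℚ_[p]) = x i / x j := by
        refine ⟨⟨x i / x j, ?_⟩, rfl⟩
        rw [norm_div]
        exact div_le_one_of_le₀ (hj i (Finset.mem_univ i)) (norm_nonneg _)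
      choose y hy using hy
      refine ⟨y, ⟨j, Subtype.ext ((hy j).trans (div_self hj0))⟩, Subtype.ext ?_⟩
      refine (hcast y).trans ?_
      have : ∑ i, (a i : ℚ_[p]) * (y i : ℚ_[p]) ^ k
          = (∑ i, (a i : ℚ_[p]) * x i ^ k) / x j ^ k := by
        rw [Finset.sum_div]
        exact Finset.sum_congr rfl fun i _ => by rw [hy, div_pow, mul_div_assoc]
      rw [this, h, zero_div]
      rfl
    · rintro ⟨x, ⟨j, hj⟩, h⟩
      refine ⟨fun i => (x i : ℚ_[p]), fun h0 => ?_, ?_⟩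
      · have := congrFun h0 j
        simp [hj] at this
      · exact (hcast x).symm.trans (congrArg (fun z : ℤ_[p] => (z : ℚ_[p])) h)
  rw [key]
  refine isClosedMap_fst_of_compactSpace _ (IsClosed.inter ?_ ?_)
  · have : {q : (Fin (n + 1) → ℤ_[p]) × (Fin (n + 1) → ℤ_[p]) | ∃ i, q.2 i = 1}
        = ⋃ i, {q | q.2 i = 1} := by
      ext q
      simp
    show IsClosed {q : (Fin (n + 1) → ℤ_[p]) × (Fin (n + 1) → ℤ_[p]) | ∃ i, q.2 i = 1}
    rw [this]
    exact isClosed_iUnion_of_finite fun i => isClosed_eq (by fun_prop) continuous_const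
  · exact isClosed_eq (by fun_prop) continuous_const

/-- The soluble set is measurable for the product σ-algebra on `ℤ_p^{n+1}`. -/
theorem measurableSet_solubleSet (p : ℕ) [Fact p.Prime] (n k : ℕ) :
    MeasurableSet (solubleSet p n k) :=
  (isClosed_solubleSet p n k).measurableSet

/-- The density `ρ_p(n, k)`: the measure of the soluble set for the product of the normalized
Haar measures on `ℤ_p^{n+1}`. -/
noncomputable def rho (p : ℕ) [Fact p.Prime] (n k : ℕ) : ℝ :=
  (Measure.pi (fun _ : Fin (n + 1) => padicHaar p)).real (solubleSet p n k)

/-! Solubility depends only on the classes of the coefficients modulo cubes. Up to a null set `ℤ_p`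
splits into finitely many classes, represented by `p ^ r * e j` with "level" `r < 3` and `e j` a
unit. The class of `c` is the dilate by `c` of the class of `1`, so its measure is proportional to
`‖c‖` (`padicHaar_powerClass`). A vanishing coefficient, or two coefficients in one class, gives a
rational point, since `-1` is a cube. So insoluble vectors correspond to injections of the indices
onto an insoluble set of classes, each set arising `(n + 1)!` times. This gives `rho_eq` and, sorted
by total level, `rho_eq_levelCount`. It remains to recognize insoluble sets of classes. Scaling a
zero by its largest term, and shifting levels cyclically, makes it integral with a unit coordinate
in level `0` (`hasZeroOn_levelRep_iff`); reduction modulo `p`, or modulo `9` if `p = 3`, and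
Hensel's lemma then decide. For `p ≡ 2 mod 3` every unit is a cube, the three classes have distinct
valuations modulo 3, and every set is insoluble. For `p ≡ 1 mod 3` a set is insoluble iff it
contains no full level (`noFullLevel_iff`): two-term forms are anisotropic modulo `p`, while `x³ + γ
y³ + γ² z³` is isotropic (`exists_diagonal_cubic_zero`). For `p = 3` the unit cubes are the units
`±1` modulo `9`, and solubility needs two classes in one level and one in the next
(`noPairBeforeLevel_iff`). The level counts are then finite enumerations in a set of at most nine
classes. -/

/-! ### Scaling of Haar measure on `ℤ_p`. -/

instance padicHaar_isAddHaarMeasure (p : ℕ) [Fact p.Prime] : (padicHaar p).IsAddHaarMeasure := by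
  unfold padicHaar; infer_instance

theorem measurableEmbedding_mul_left {p : ℕ} [Fact p.Prime] {c : ℤ_[p]} (hc : c ≠ 0) :
    MeasurableEmbedding (fun x : ℤ_[p] => c * x) :=
  ((continuous_const_mul c).isClosedEmbedding (mul_right_injective₀ hc)).measurableEmbedding

/-- Up to the total mass, multiplication by `c ≠ 0` scales Haar measure. -/
theorem padicHaar_image_mul_left_aux {p : ℕ} [Fact p.Prime] {c : ℤ_[p]} (hc : c ≠ 0)
    (s : Set ℤ_[p]) :
    padicHaar p ((fun x => c * x) '' s) =
      padicHaar p (Set.range (fun x : ℤ_[p] => c * x)) * padicHaar p s := by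
  have he := measurableEmbedding_mul_left hc
  -- The pullback of Haar measure along `x ↦ c * x` is again translation invariant, hence a multiple
  -- of Haar measure; evaluating on the whole space gives the factor.
  have hinv : ((padicHaar p).comap (fun x => c * x)).IsAddLeftInvariant := by
    refine ⟨fun g => Measure.ext fun t ht => ?_⟩
    rw [Measure.map_apply (measurable_const_add g) ht, he.comap_apply, he.comap_apply,
      ← measure_preimage_add (padicHaar p) (c * g) ((fun x => c * x) '' t)]
    congr 1
    ext y
    simp only [Set.mem_image, Set.mem_preimage]
    constructor
    · rintro ⟨x, hx, h⟩
      exact ⟨g + x, hx, by linear_combination h⟩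
    · rintro ⟨x, hx, h⟩
      exact ⟨x - g, by simpa using hx, by linear_combination h⟩
  have hfin : IsFiniteMeasure ((padicHaar p).comap (fun x => c * x)) :=
    ⟨by rw [he.comap_apply]; exact measure_lt_top _ _⟩
  have h := Measure.isAddLeftInvariant_eq_smul
    ((padicHaar p).comap (fun x => c * x)) (padicHaar p)
  have h1 := congrArg (fun ν : Measure ℤ_[p] => ν s) h
  have h2 := congrArg (fun ν : Measure ℤ_[p] => ν Set.univ) h
  simp only [he.comap_apply, Measure.smul_apply, measure_univ, Set.image_univ] at h1 h2
  rw [h1, h2]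
  simp [ENNReal.smul_def]

/-- The multiples of `p` form the kernel of reduction modulo `p`, a subgroup of index `p` whose
cosets have equal measure. -/
theorem padicHaar_range_mul_prime (p : ℕ) [Fact p.Prime] :
    padicHaar p (Set.range (fun x : ℤ_[p] => (p : ℤ_[p]) * x)) = (p : ENNReal)⁻¹ := by
  let H : AddSubgroup ℤ_[p] := (PadicInt.toZMod (p := p)).toAddMonoidHom.ker
  have hH : (H : Set ℤ_[p]) = Set.range (fun x : ℤ_[p] => (p : ℤ_[p]) * x) := by
    ext x
    have : x ∈ (H : Set ℤ_[p]) ↔ x ∈ RingHom.ker (PadicInt.toZMod (p := p)) := Iff.rfl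
    rw [this, PadicInt.ker_toZMod, PadicInt.maximalIdeal_eq_span_p, Ideal.mem_span_singleton]
    exact ⟨fun ⟨y, hy⟩ => ⟨y, hy.symm⟩, fun ⟨y, hy⟩ => ⟨y, hy.symm⟩⟩
  have hp : p ≠ 0 := (Fact.out : p.Prime).ne_zero
  have hindex : H.index = p := by
    rw [AddSubgroup.index_ker]
    have : (PadicInt.toZMod (p := p)).toAddMonoidHom.range = ⊤ :=
      AddMonoidHom.range_eq_top.2 (ZMod.ringHom_surjective _)
    rw [this]
    simp
  have : H.FiniteIndex := ⟨by rwa [hindex]⟩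
  have hmeas : MeasurableSet (H : Set ℤ_[p]) := by
    rw [hH]
    exact (measurableEmbedding_mul_left (Nat.cast_ne_zero.2 hp)).measurableSet_range
  have h := AddSubgroup.index_mul_measure H hmeas (padicHaar p)
  rw [hindex, measure_univ, hH] at h
  rw [← ENNReal.eq_inv_of_mul_eq_one_left (by rwa [mul_comm] at h)]

/-- Multiplication by `c ≠ 0` scales Haar measure on `ℤ_p` by `‖c‖`. -/
theorem padicHaar_real_image_mul_left {p : ℕ} [Fact p.Prime] {c : ℤ_[p]} (hc : c ≠ 0)
    (s : Set ℤ_[p]) :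
    (padicHaar p).real ((fun x => c * x) '' s) = ‖c‖ * (padicHaar p).real s := by
  suffices h : (padicHaar p).real (Set.range (fun x : ℤ_[p] => c * x)) = ‖c‖ by
    rw [Measure.real, padicHaar_image_mul_left_aux hc, ENNReal.toReal_mul, ← Measure.real, h,
      ← Measure.real]
  have hp : (p : ℤ_[p]) ≠ 0 := Nat.cast_ne_zero.2 (Fact.out : p.Prime).ne_zero
  have hpow (k : ℕ) : ∀ t : Set ℤ_[p], (padicHaar p).real ((fun x => (p : ℤ_[p]) ^ k * x) '' t) =
      ((p : ℝ)⁻¹) ^ k * (padicHaar p).real t := by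
    induction k with
    | zero => simp
    | succ k ih =>
      intro t
      have : (fun x => (p : ℤ_[p]) ^ (k + 1) * x) '' t =
          (fun x => (p : ℤ_[p]) ^ k * x) '' ((fun x => (p : ℤ_[p]) * x) '' t) := by
        rw [Set.image_image]
        congr 1
        ext x
        ring_nf
      rw [this, ih, Measure.real, padicHaar_image_mul_left_aux hp, padicHaar_range_mul_prime,
        ENNReal.toReal_mul]
      simp [Measure.real]
      ring
  -- Up to a unit, `c` is a power of `p`, so both generate the same ideal.
  have hrange : Set.range (fun x : ℤ_[p] => c * x) =
      (fun x => (p : ℤ_[p]) ^ c.valuation * x) '' Set.univ := by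
    ext y
    have hcs := PadicInt.unitCoeff_spec hc
    generalize PadicInt.unitCoeff hc = u at hcs
    simp only [Set.mem_range, Set.image_univ]
    constructor
    · rintro ⟨x, rfl⟩
      exact ⟨u * x, by linear_combination -x * hcs⟩
    · rintro ⟨x, rfl⟩
      exact ⟨(u⁻¹ : ℤ_[p]ˣ) * x, by
        linear_combination (u⁻¹ : ℤ_[p]ˣ) * x * hcs + (p : ℤ_[p]) ^ c.valuation * x * u.mul_inv⟩
  rw [hrange, hpow, PadicInt.norm_eq_zpow_neg_valuation hc]
  simp

/-- Multiplication by `p` fixes `{0}` but divides its measure by `p`. -/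
theorem padicHaar_singleton_zero (p : ℕ) [Fact p.Prime] : (padicHaar p).real {0} = 0 := by
  have hp := (Fact.out : p.Prime)
  have h := padicHaar_real_image_mul_left (c := (p : ℤ_[p])) (Nat.cast_ne_zero.2 hp.ne_zero) {0}
  rw [Set.image_singleton, mul_zero, PadicInt.norm_p] at h
  have h1 : (p : ℝ)⁻¹ < 1 := inv_lt_one_of_one_lt₀ (by exact_mod_cast hp.one_lt)
  nlinarith

/-! ### Classes modulo `k`-th powers and their measure. -/

/-- The nonzero elements of `ℤ_p` that differ from `c` by a `k`-th power. -/
def powerClass {p : ℕ} [Fact p.Prime] (k : ℕ) (c : ℤ_[p]) : Set ℤ_[p] :=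
  {a | a ≠ 0 ∧ ∃ x, a = c * x ^ k}

theorem powerClass_eq_image {p : ℕ} [Fact p.Prime] (k : ℕ) {c : ℤ_[p]} (hc : c ≠ 0) :
    powerClass k c = (fun x => c * x) '' powerClass k 1 := by
  ext a
  simp only [powerClass, Set.mem_ofPred_eq, Set.mem_image, one_mul]
  constructor
  · rintro ⟨h0, x, rfl⟩
    exact ⟨x ^ k, ⟨right_ne_zero_of_mul h0, x, rfl⟩, rfl⟩
  · rintro ⟨_, ⟨h0, x, rfl⟩, rfl⟩
    exact ⟨mul_ne_zero hc h0, x, rfl⟩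

theorem measurableSet_powerClass {p : ℕ} [Fact p.Prime] (k : ℕ) (c : ℤ_[p]) :
    MeasurableSet (powerClass k c) := by
  have : powerClass k c = {0}ᶜ ∩ Set.range (fun x => c * x ^ k) := by
    ext a
    simp [powerClass, eq_comm]
  rw [this]
  refine (MeasurableSet.singleton 0).compl.inter (IsClosed.measurableSet ?_)
  exact (isCompact_range (by fun_prop)).isClosed

/-- If the classes of `rep c` partition the nonzero elements, then the class of `rep c` has
measure proportional to `‖rep c‖`. -/
theorem padicHaar_powerClass {p : ℕ} [Fact p.Prime] (k : ℕ) {C : Type*} [Fintype C]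
    (rep : C → ℤ_[p]) (h0 : ∀ c, rep c ≠ 0)
    (hex : ∀ a : ℤ_[p], a ≠ 0 → ∃ c, a ∈ powerClass k (rep c))
    (hdisj : Pairwise fun c d => Disjoint (powerClass k (rep c)) (powerClass k (rep d))) (c : C) :
    (padicHaar p).real (powerClass k (rep c)) = ‖rep c‖ / ∑ d, ‖rep d‖ := by
  have hm (c : C) : (padicHaar p).real (powerClass k (rep c)) =
      ‖rep c‖ * (padicHaar p).real (powerClass k 1) := by
    rw [powerClass_eq_image k (h0 c), padicHaar_real_image_mul_left (h0 c)]
  have hU : ⋃ c, powerClass k (rep c) = {0}ᶜ := by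
    ext a
    simp only [Set.mem_iUnion, Set.mem_compl_iff, Set.mem_singleton_iff]
    exact ⟨fun ⟨c, hc⟩ => hc.1, hex a⟩
  have hsum : ∑ c, (padicHaar p).real (powerClass k (rep c)) = 1 := by
    rw [← measureReal_iUnion_fintype hdisj (fun c => measurableSet_powerClass k _), hU,
      probReal_compl_eq_one_sub (MeasurableSet.singleton 0), padicHaar_singleton_zero, sub_zero]
  simp only [hm, ← Finset.sum_mul] at hsum
  rw [hm, eq_div_iff (left_ne_zero_of_mul (hsum ▸ one_ne_zero))]
  linear_combination ‖rep c‖ * hsum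

/-! ### Solubility in terms of classes. -/

/-- The diagonal form of degree `k` with coefficients `a i`, `i ∈ S`, has a nontrivial zero
over `ℚ_p`. -/
def HasZeroOn {p : ℕ} [Fact p.Prime] (k : ℕ) {ι : Type*} (a : ι → ℤ_[p]) (S : Finset ι) : Prop :=
  ∃ x : ι → ℚ_[p], (∃ i ∈ S, x i ≠ 0) ∧ ∑ i ∈ S, (a i : ℚ_[p]) * x i ^ k = 0

theorem mem_solubleSet_iff {p : ℕ} [Fact p.Prime] {n k : ℕ} {a : Fin (n + 1) → ℤ_[p]} :
    a ∈ solubleSet p n k ↔ HasZeroOn k a Finset.univ := by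
  simp only [solubleSet, Set.mem_ofPred_eq, diagonalPoints_nonempty_iff, HasZeroOn,
    Finset.mem_univ, true_and, Function.ne_iff, Pi.zero_apply]

theorem hasZeroOn_of_eq_zero {p : ℕ} [Fact p.Prime] {k : ℕ} (hk : k ≠ 0) {ι : Type*}
    {a : ι → ℤ_[p]} {S : Finset ι} {i : ι} (hi : i ∈ S) (h : a i = 0) : HasZeroOn k a S := by
  classical
  refine ⟨Pi.single i 1, ⟨i, hi, by simp⟩, Finset.sum_eq_zero fun j _ => ?_⟩
  rcases eq_or_ne j i with rfl | hj
  · simp [h]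
  · simp [Pi.single_eq_of_ne hj, hk]

/-- The `k`-th power factors are nonzero and are absorbed into the variables over `ℚ_p`. -/
theorem hasZeroOn_congr_powerClass {p : ℕ} [Fact p.Prime] {k : ℕ} (hk : k ≠ 0) {ι : Type*}
    {a b : ι → ℤ_[p]} (h : ∀ i, a i ∈ powerClass k (b i)) (S : Finset ι) :
    HasZeroOn k a S ↔ HasZeroOn k b S := by
  choose h0 z hz using h
  have hz0 (i : ι) : (z i : ℚ_[p]) ≠ 0 := by
    intro hi
    refine h0 i ?_
    rw [hz i, PadicInt.coe_eq_zero.1 hi, zero_pow hk, mul_zero]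
  constructor
  · rintro ⟨x, ⟨i, hi, hx⟩, hs⟩
    refine ⟨fun i => z i * x i, ⟨i, hi, mul_ne_zero (hz0 i) hx⟩, ?_⟩
    rw [← hs]
    refine Finset.sum_congr rfl fun j _ => ?_
    rw [hz j, PadicInt.coe_mul, PadicInt.coe_pow]
    ring
  · rintro ⟨x, ⟨i, hi, hx⟩, hs⟩
    refine ⟨fun i => x i / z i, ⟨i, hi, div_ne_zero hx (hz0 i)⟩, ?_⟩
    rw [← hs]
    refine Finset.sum_congr rfl fun j _ => ?_
    rw [hz j, PadicInt.coe_mul, PadicInt.coe_pow, div_pow, mul_assoc,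
      mul_div_cancel₀ _ (pow_ne_zero k (hz0 j))]

/-- Two coefficients in the same class give a nontrivial zero. -/
theorem hasZeroOn_of_eq {p : ℕ} [Fact p.Prime] {k : ℕ} (hk : Odd k) {ι : Type*}
    {a : ι → ℤ_[p]} {S : Finset ι} {i j : ι} (hi : i ∈ S) (hj : j ∈ S) (hij : i ≠ j)
    (h : a i = a j) : HasZeroOn k a S := by
  classical
  have hk0 : k ≠ 0 := hk.pos.ne'
  refine ⟨Pi.single i 1 + Pi.single j (-1), ⟨i, hi, by simp [hij]⟩, ?_⟩
  rw [Finset.sum_eq_add_of_mem i j hi hj hij]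
  · simp [hij, hij.symm, h, hk.neg_one_pow]
  · rintro l - ⟨h1, h2⟩
    simp [h1, h2, hk0]

theorem hasZeroOn_comp_iff {p : ℕ} [Fact p.Prime] {k : ℕ} {ι C : Type*} [Fintype ι]
    [DecidableEq C] {rep : C → ℤ_[p]} {g : ι → C} (hg : Function.Injective g) :
    HasZeroOn k (fun i => rep (g i)) Finset.univ ↔ HasZeroOn k rep (Finset.univ.image g) := by
  constructor
  · rintro ⟨x, ⟨i, -, hx⟩, hs⟩
    refine ⟨Function.extend g x 0, ⟨g i, by simp, by rwa [hg.extend_apply]⟩, ?_⟩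
    rw [Finset.sum_image (fun a _ b _ h => hg h)]
    simpa only [hg.extend_apply] using hs
  · rintro ⟨x, ⟨c, hc, hx⟩, hs⟩
    obtain ⟨i, -, rfl⟩ := Finset.mem_image.1 hc
    refine ⟨x ∘ g, ⟨i, Finset.mem_univ i, hx⟩, ?_⟩
    rwa [Finset.sum_image (fun a _ b _ h => hg h)] at hs

/-- A common element, written in both ways as representative times `x ^ k` or `y ^ k`, would give
the zero `(x, -y)` of the two-term form, `k` being odd. -/
theorem disjoint_powerClass {p : ℕ} [Fact p.Prime] {k : ℕ} (hk : Odd k) {C : Type*}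
    [DecidableEq C] {rep : C → ℤ_[p]} {c d : C} (hcd : c ≠ d)
    (h : ¬ HasZeroOn k rep {c, d}) : Disjoint (powerClass k (rep c)) (powerClass k (rep d)) := by
  rw [Set.disjoint_left]
  rintro a ⟨h0, x, hx⟩ ⟨-, y, hy⟩
  refine h ⟨Pi.single c (x : ℚ_[p]) + Pi.single d (-(y : ℚ_[p])), ⟨c, by simp, ?_⟩, ?_⟩
  · intro hx0
    have : x = 0 := by simpa [hcd] using hx0
    exact h0 (by rw [hx, this, zero_pow hk.pos.ne', mul_zero])
  · have h1 : (rep c : ℚ_[p]) * (x : ℚ_[p]) ^ k = rep d * (y : ℚ_[p]) ^ k := by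
      exact_mod_cast congrArg (fun z : ℤ_[p] => (z : ℚ_[p])) (hx.symm.trans hy)
    rw [Finset.sum_pair hcd]
    simp [hcd, hcd.symm, hk.neg_pow, h1]

/-! ### The density as a sum over insoluble sets of classes. -/

/-- There are `m!` injections from `Fin m` with a given image of cardinality `m`. -/
theorem card_injective_image_eq {C : Type*} [Fintype C] [DecidableEq C] {m : ℕ} {S : Finset C}
    (hS : S.card = m) :
    (Finset.univ.filter fun g : Fin m → C =>
      Function.Injective g ∧ Finset.univ.image g = S).card = m.factorial := by
  have e : Fin m ≃ S := (S.equivFinOfCardEq hS).symm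
  have hcard : Fintype.card (Fin m ≃ S) = m.factorial := by
    rw [Fintype.card_equiv e, Fintype.card_fin]
  rw [← hcard, ← Finset.card_univ]
  symm
  refine Finset.card_bij (fun f _ i => (f i : C)) ?_ ?_ ?_
  · intro f _
    simp only [Finset.mem_filter, Finset.mem_univ, true_and]
    refine ⟨Subtype.val_injective.comp f.injective, ?_⟩
    ext c
    simp only [Finset.mem_image, Finset.mem_univ, true_and]
    exact ⟨fun ⟨i, hi⟩ => hi ▸ (f i).2, fun hc => ⟨f.symm ⟨c, hc⟩, by simp⟩⟩
  · intro f _ f' _ h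
    ext i
    exact congrFun h i
  · intro g hg
    simp only [Finset.mem_filter, Finset.mem_univ, true_and] at hg
    obtain ⟨hg, rfl⟩ := hg
    refine ⟨Equiv.ofBijective (fun i => ⟨g i, Finset.mem_image_of_mem g (Finset.mem_univ i)⟩)
      ⟨fun i j h => hg (congrArg Subtype.val h), ?_⟩, Finset.mem_univ _, rfl⟩
    rintro ⟨c, hc⟩
    obtain ⟨i, -, rfl⟩ := Finset.mem_image.1 hc
    exact ⟨i, rfl⟩

theorem sum_injective_eq_factorial_mul {C : Type*} [Fintype C] [DecidableEq C] (m : ℕ)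
    (D : Finset C → Prop) [DecidablePred D] (w : C → ℝ) :
    ∑ g : Fin m → C with Function.Injective g ∧ D (Finset.univ.image g), ∏ i, w (g i) =
      m.factorial * ∑ S ∈ Finset.powersetCard m Finset.univ with D S, ∏ c ∈ S, w c := by
  rw [← Finset.sum_fiberwise_of_maps_to (g := fun g : Fin m → C => Finset.univ.image g)
    (t := (Finset.powersetCard m Finset.univ).filter D), Finset.mul_sum]
  · refine Finset.sum_congr rfl fun S hS => ?_
    rw [Finset.mem_filter, Finset.mem_powersetCard] at hS
    rw [Finset.sum_congr rfl (g := fun _ => ∏ c ∈ S, w c), Finset.sum_const, nsmul_eq_mul,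
      ← card_injective_image_eq hS.1.2]
    · congr 3
      ext g
      simp only [Finset.mem_filter, Finset.mem_univ, true_and]
      exact ⟨fun h => ⟨h.1.1, h.2⟩, fun h => ⟨⟨h.1, h.2 ▸ hS.2⟩, h.2⟩⟩
    · intro g hg
      simp only [Finset.mem_filter, Finset.mem_univ, true_and] at hg
      rw [← hg.2, Finset.prod_image (fun a _ b _ h => hg.1.1 h)]
  · intro g hg
    simp only [Finset.mem_filter, Finset.mem_univ, true_and] at hg
    rw [Finset.mem_filter, Finset.mem_powersetCard]
    exact ⟨⟨Finset.subset_univ _, by rw [Finset.card_image_of_injective _ hg.1]; simp⟩, hg.2⟩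

/-- The density in terms of the insoluble sets of classes modulo `k`-th powers. -/
theorem rho_eq {p : ℕ} [Fact p.Prime] {k : ℕ} (hk : Odd k) {C : Type*} [Fintype C]
    [DecidableEq C] (rep : C → ℤ_[p]) (h0 : ∀ c, rep c ≠ 0)
    (hex : ∀ a : ℤ_[p], a ≠ 0 → ∃ c, a ∈ powerClass k (rep c))
    (D : Finset C → Prop) [DecidablePred D] (hD : ∀ S, D S ↔ ¬ HasZeroOn k rep S)
    (hpair : ∀ c d, c ≠ d → D {c, d}) (n : ℕ) :
    rho p n k = 1 - (n + 1).factorial *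
      ∑ S ∈ Finset.powersetCard (n + 1) Finset.univ with D S,
        ∏ c ∈ S, (‖rep c‖ / ∑ d, ‖rep d‖) := by
  have hk0 : k ≠ 0 := hk.pos.ne'
  have hdisj : Pairwise fun c d => Disjoint (powerClass k (rep c)) (powerClass k (rep d)) :=
    fun c d hcd => disjoint_powerClass hk hcd ((hD _).1 (hpair c d hcd))
  let G : Finset (Fin (n + 1) → C) :=
    Finset.univ.filter fun g => Function.Injective g ∧ D (Finset.univ.image g)
  -- The insoluble vectors form a disjoint union of boxes, one for each injective assignment of
  -- classes with insoluble image.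
  have hcompl : (solubleSet p n k)ᶜ =
      ⋃ g ∈ G, Set.univ.pi fun i => powerClass k (rep (g i)) := by
    ext a
    simp only [Set.mem_compl_iff, mem_solubleSet_iff, Set.mem_iUnion, Set.mem_univ_pi, G,
      Finset.mem_filter, Finset.mem_univ, true_and, exists_prop]
    constructor
    · intro ha
      have h1 (i : Fin (n + 1)) : ∃ c, a i ∈ powerClass k (rep c) :=
        hex _ fun h => ha (hasZeroOn_of_eq_zero hk0 (Finset.mem_univ i) h)
      choose g hg using h1
      rw [hasZeroOn_congr_powerClass hk0 hg] at ha
      have hinj : Function.Injective g := by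
        intro i j hij
        by_contra hne
        exact ha (hasZeroOn_of_eq hk (Finset.mem_univ i) (Finset.mem_univ j) hne (by rw [hij]))
      rw [hasZeroOn_comp_iff hinj] at ha
      exact ⟨g, ⟨hinj, (hD _).2 ha⟩, hg⟩
    · rintro ⟨g, ⟨hinj, hg⟩, ha⟩
      rw [hasZeroOn_congr_powerClass hk0 ha, hasZeroOn_comp_iff hinj]
      exact (hD _).1 hg
  have hmeas : (Measure.pi (fun _ : Fin (n + 1) => padicHaar p)).real (solubleSet p n k)ᶜ =
      ∑ g ∈ G, ∏ i, (‖rep (g i)‖ / ∑ d, ‖rep d‖) := by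
    rw [hcompl, measureReal_biUnion_finset]
    · refine Finset.sum_congr rfl fun g _ => ?_
      rw [Measure.real, Measure.pi_pi, ENNReal.toReal_prod]
      exact Finset.prod_congr rfl fun i _ => padicHaar_powerClass k rep h0 hex hdisj (g i)
    · intro g _ g' _ hne
      obtain ⟨i, hi⟩ := Function.ne_iff.1 hne
      exact Set.disjoint_univ_pi.2 ⟨i, hdisj hi⟩
    · exact fun g _ => MeasurableSet.univ_pi fun i => measurableSet_powerClass k _
  rw [probReal_compl_eq_one_sub (measurableSet_solubleSet p n k)] at hmeas
  rw [rho, ← sum_injective_eq_factorial_mul (n + 1) D fun c => ‖rep c‖ / ∑ d, ‖rep d‖]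
  linarith

/-! ### Cube classes by level, and normalized zeros. -/

/-- The representatives `p ^ r * e j` of the classes of `ℚ_pˣ` modulo cubes, for a family `e`
of representatives of the unit classes. -/
noncomputable def levelRep {p : ℕ} [Fact p.Prime] {J : Type*} (e : J → ℤ_[p]) (c : Fin 3 × J) : ℤ_[p] :=
  (p : ℤ_[p]) ^ (c.1 : ℕ) * e c.2

theorem norm_le_one_of_norm_pow_mul_le {p : ℕ} [Fact p.Prime] {y : ℚ_[p]} (i : Fin 3)
    (h : ‖(p : ℚ_[p]) ^ (i : ℕ) * y ^ 3‖ ≤ 1) : ‖y‖ ≤ 1 := by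
  have hp : (1 : ℝ) < p := by exact_mod_cast (Fact.out : p.Prime).one_lt
  have h1 := Padic.norm_le_pow_iff_norm_lt_pow_add_one y 0
  rw [zpow_zero, zero_add, zpow_one] at h1
  rw [h1]
  by_contra! hy
  have hy3 : (p : ℝ) ^ 3 ≤ ‖y‖ ^ 3 := by gcongr
  rw [norm_mul, norm_pow, norm_pow, Padic.norm_p, inv_pow, inv_mul_le_iff₀ (by positivity),
    mul_one] at h
  have hi : (p : ℝ) ^ (i : ℕ) < (p : ℝ) ^ 3 := pow_lt_pow_right₀ hp i.2
  linarith

/-- Addition in `Fin 3` wraps around; the lost factor `p ^ 3` is a cube, so `q` is `1` or `p⁻¹`.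
This permits any level to be moved to level `0`. -/
theorem exists_pow_add_eq {p : ℕ} [Fact p.Prime] (r i : Fin 3) :
    ∃ q : ℚ_[p], q ≠ 0 ∧ (p : ℚ_[p]) ^ ((r + i : Fin 3) : ℕ) =
      (p : ℚ_[p]) ^ (r : ℕ) * (p : ℚ_[p]) ^ (i : ℕ) * q ^ 3 := by
  have hp : (p : ℚ_[p]) ≠ 0 := Nat.cast_ne_zero.2 (Fact.out : p.Prime).ne_zero
  by_cases h : (r : ℕ) + i < 3
  · exact ⟨1, one_ne_zero, by rw [Fin.val_add_eq_of_add_lt h, pow_add, one_pow, mul_one]⟩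
  · refine ⟨(p : ℚ_[p])⁻¹, inv_ne_zero hp, ?_⟩
    have hv : ((r + i : Fin 3) : ℕ) + 3 = r + i := by omega
    rw [← pow_add, ← hv, pow_add]
    field_simp

theorem sum_fin_three_prod_shift {M J : Type*} [AddCommMonoid M] [Fintype J]
    (r : Fin 3) (f : Fin 3 × J → M) : ∑ c, f c = ∑ i : Fin 3, ∑ j, f (r + i, j) := by
  rw [Fintype.sum_prod_type, ← Equiv.sum_comp (Equiv.addLeft r)]
  rfl

/-- A nontrivial zero can be normalized to be integral, with a term of minimal valuation
at a unit coordinate. -/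
theorem hasZeroOn_levelRep_iff {p : ℕ} [Fact p.Prime] {J : Type*} [Fintype J] [DecidableEq J]
    {e : J → ℤ_[p]} (he : ∀ j, IsUnit (e j)) (S : Finset (Fin 3 × J)) :
    HasZeroOn 3 (levelRep e) S ↔ ∃ (r : Fin 3) (y : Fin 3 → J → ℤ_[p]),
      (∀ i j, (r + i, j) ∉ S → y i j = 0) ∧ (∃ j, IsUnit (y 0 j)) ∧
        ∑ i : Fin 3, (p : ℤ_[p]) ^ (i : ℕ) * ∑ j, e j * y i j ^ 3 = 0 := by
  have hp : (p : ℚ_[p]) ≠ 0 := Nat.cast_ne_zero.2 (Fact.out : p.Prime).ne_zero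
  have hen (j : J) : ‖(e j : ℚ_[p])‖ = 1 := PadicInt.isUnit_iff.1 (he j)
  have hrep (c : Fin 3 × J) : (levelRep e c : ℚ_[p]) = (p : ℚ_[p]) ^ (c.1 : ℕ) * e c.2 := by
    simp [levelRep]
  constructor
  · rintro ⟨x', ⟨c₁, hc₁, hx₁⟩, hs'⟩
    obtain ⟨x, hxS, hx1, hs⟩ : ∃ x : Fin 3 × J → ℚ_[p], (∀ c ∉ S, x c = 0) ∧ x c₁ ≠ 0 ∧
        ∑ c, (levelRep e c : ℚ_[p]) * x c ^ 3 = 0 := by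
      refine ⟨fun c => if c ∈ S then x' c else 0, fun c hc => if_neg hc, by simp [hc₁, hx₁], ?_⟩
      refine Eq.trans ?_ hs'
      rw [← Finset.sum_subset (Finset.subset_univ S)]
      · exact Finset.sum_congr rfl fun c hc => by simp only [if_pos hc]
      · exact fun c _ hc => by simp [hc]
    -- Let `(r, j₀)` index a term of largest norm. Dividing the equation by `p ^ r * x (r, j₀) ^ 3`
    -- leaves all terms integral, and since levels are below 3 this forces the new variables to be
    -- integral.
    obtain ⟨⟨r, j₀⟩, -, hmax⟩ := Finset.exists_max_image Finset.univ
      (fun c => ‖(levelRep e c : ℚ_[p]) * x c ^ 3‖) ⟨c₁, Finset.mem_univ _⟩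
    have hX : x (r, j₀) ≠ 0 := by
      intro h0
      have h := hmax c₁ (Finset.mem_univ _)
      rw [h0, zero_pow three_ne_zero, mul_zero, norm_zero, norm_le_zero_iff, hrep] at h
      exact mul_ne_zero (mul_ne_zero (pow_ne_zero _ hp)
        (norm_ne_zero_iff.1 (by rw [hen]; exact one_ne_zero))) (pow_ne_zero 3 hx1) h
    choose q hq0 hq using exists_pow_add_eq (p := p) r
    have hterm (i : Fin 3) (j : J) : (levelRep e (r + i, j) : ℚ_[p]) * x (r + i, j) ^ 3 =
        (p : ℚ_[p]) ^ (r : ℕ) * x (r, j₀) ^ 3 *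
          ((p : ℚ_[p]) ^ (i : ℕ) * (e j * (q i * x (r + i, j) / x (r, j₀)) ^ 3)) := by
      rw [hrep, hq]
      field_simp
    have hint (i : Fin 3) (j : J) :
        ∃ y : ℤ_[p], (y : ℚ_[p]) = q i * x (r + i, j) / x (r, j₀) := by
      refine ⟨⟨_, norm_le_one_of_norm_pow_mul_le i ?_⟩, rfl⟩
      have h := hmax (r + i, j) (Finset.mem_univ _)
      have h0 : ‖(levelRep e (r, j₀) : ℚ_[p]) * x (r, j₀) ^ 3‖ =
          ‖(p : ℚ_[p]) ^ (r : ℕ) * x (r, j₀) ^ 3‖ := by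
        simp only [hrep, norm_mul, hen, mul_one]
      have h1 (z w : ℚ_[p]) : ‖w * (e j * z)‖ = ‖w * z‖ := by
        simp only [norm_mul, hen, one_mul]
      rw [hterm, h0, norm_mul, h1] at h
      refine le_of_mul_le_mul_left (a := ‖(p : ℚ_[p]) ^ (r : ℕ) * x (r, j₀) ^ 3‖) ?_ ?_
      · rwa [mul_one]
      · exact norm_pos_iff.2 (mul_ne_zero (pow_ne_zero _ hp) (pow_ne_zero 3 hX))
    choose y hy using hint
    refine ⟨r, y, ?_, ⟨j₀, ?_⟩, ?_⟩
    · intro i j hij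
      exact PadicInt.ext (by simp [hy, hxS _ hij])
    -- The coordinate at `j₀` becomes `q 0`, which has norm `1` because a shift by `0` changes
    -- nothing.
    · have hq3 : q 0 ^ 3 = 1 := by
        have := hq 0
        simp only [add_zero, Fin.val_zero, pow_zero, mul_one] at this
        exact (mul_eq_left₀ (pow_ne_zero _ hp)).1 this.symm
      rw [PadicInt.isUnit_iff, PadicInt.norm_def, hy]
      simp only [add_zero, mul_div_cancel_right₀ _ hX]
      refine (pow_eq_one_iff_of_nonneg (norm_nonneg _) three_ne_zero).1 ?_
      rw [← norm_pow, hq3, norm_one]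
    · apply PadicInt.ext
      rw [sum_fin_three_prod_shift r] at hs
      simp only [hterm, ← hy, ← Finset.mul_sum] at hs
      have hs2 := (mul_eq_zero.1 hs).resolve_left
        (mul_ne_zero (pow_ne_zero _ hp) (pow_ne_zero 3 hX))
      simpa only [PadicInt.coe_sum, PadicInt.coe_mul, PadicInt.coe_pow, PadicInt.coe_natCast,
        PadicInt.coe_zero] using hs2
  · rintro ⟨r, y, hyS, ⟨j₀, hj₀⟩, hs⟩
    choose q hq0 hq using exists_pow_add_eq (p := p) r
    have hr (c : Fin 3 × J) : (r + (c.1 - r), c.2) = c := by simp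
    refine ⟨fun c => (y (c.1 - r) c.2 : ℚ_[p]) / q (c.1 - r), ⟨(r, j₀), ?_, ?_⟩, ?_⟩
    · by_contra h
      have := hyS 0 j₀ (by simpa using h)
      rw [this] at hj₀
      exact not_isUnit_zero hj₀
    · refine div_ne_zero ?_ (hq0 _)
      rw [PadicInt.coe_ne_zero]
      simpa using hj₀.ne_zero
    · rw [Finset.sum_subset (Finset.subset_univ S), sum_fin_three_prod_shift r]
      · have h2 := congrArg (fun z : ℤ_[p] => (z : ℚ_[p])) hs
        simp only [PadicInt.coe_sum, PadicInt.coe_mul, PadicInt.coe_pow, PadicInt.coe_natCast,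
          PadicInt.coe_zero] at h2
        rw [← mul_zero ((p : ℚ_[p]) ^ (r : ℕ)), ← h2, Finset.mul_sum]
        refine Finset.sum_congr rfl fun i _ => ?_
        rw [Finset.mul_sum, Finset.mul_sum]
        refine Finset.sum_congr rfl fun j _ => ?_
        have := hq0 i
        simp only [hrep, add_sub_cancel_left, hq]
        field_simp
      · intro c _ hc
        simp [hyS (c.1 - r) c.2 (by rwa [hr])]

theorem levelRep_ne_zero {p : ℕ} [Fact p.Prime] {J : Type*} {e : J → ℤ_[p]}
    (he : ∀ j, IsUnit (e j)) (c : Fin 3 × J) : levelRep e c ≠ 0 :=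
  mul_ne_zero (pow_ne_zero _ (Nat.cast_ne_zero.2 (Fact.out : p.Prime).ne_zero)) (he c.2).ne_zero

theorem norm_levelRep {p : ℕ} [Fact p.Prime] {J : Type*} {e : J → ℤ_[p]}
    (he : ∀ j, IsUnit (e j)) (c : Fin 3 × J) : ‖levelRep e c‖ = (p : ℝ)⁻¹ ^ (c.1 : ℕ) := by
  rw [levelRep, norm_mul, norm_pow, PadicInt.norm_p, PadicInt.isUnit_iff.1 (he c.2), mul_one]

/-- The level is the valuation modulo 3; the remaining power of `p` has exponent divisible by 3 and
joins the cube. -/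
theorem exists_mem_powerClass_levelRep {p : ℕ} [Fact p.Prime] {J : Type*} {e : J → ℤ_[p]}
    (hcov : ∀ u : ℤ_[p], IsUnit u → ∃ j x, u = e j * x ^ 3) (a : ℤ_[p]) (ha : a ≠ 0) :
    ∃ c, a ∈ powerClass 3 (levelRep e c) := by
  have ha' := PadicInt.unitCoeff_spec ha
  obtain ⟨j, x, hx⟩ := hcov _ (PadicInt.unitCoeff ha).isUnit
  refine ⟨(⟨a.valuation % 3, Nat.mod_lt _ (by norm_num)⟩, j), ha,
    (p : ℤ_[p]) ^ (a.valuation / 3) * x, ?_⟩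
  rw [hx] at ha'
  refine ha'.trans ?_
  conv_lhs => rw [← Nat.mod_add_div a.valuation 3]
  simp only [levelRep]
  ring

/-! ### Cube roots of `p`-adic units. -/

/-- A version of Hensel's lemma for cube roots. -/
theorem exists_pow_three_eq {p : ℕ} [Fact p.Prime] {u t : ℤ_[p]} (ht : IsUnit t)
    (h : ‖u - t ^ 3‖ < ‖(3 : ℤ_[p])‖ ^ 2) : ∃ z : ℤ_[p], z ^ 3 = u := by
  have ht1 := PadicInt.isUnit_iff.1 ht
  obtain ⟨z, hz, -⟩ := hensels_lemma (p := p) (R := ℤ_[p])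
    (F := Polynomial.X ^ 3 - Polynomial.C u) (a := t) (by
      have h3 : (3 : ℤ_[p]) = 2 + 1 := by norm_num
      rw [h3, norm_sub_rev] at h
      simpa [ht1] using h)
  exact ⟨z, by simpa [sub_eq_zero] using hz⟩

theorem isUnit_iff_toZMod_ne_zero {p : ℕ} [Fact p.Prime] {u : ℤ_[p]} :
    IsUnit u ↔ PadicInt.toZMod u ≠ 0 := by
  rw [← not_iff_not, not_ne_iff, ← RingHom.mem_ker, PadicInt.ker_toZMod,
    IsLocalRing.mem_maximalIdeal, mem_nonunits_iff]

theorem exists_pow_three_eq_of_toZMod {p : ℕ} [Fact p.Prime] (hp : p ≠ 3) {u : ℤ_[p]}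
    {τ : ZMod p} (hτ : τ ≠ 0) (h : PadicInt.toZMod u = τ ^ 3) : ∃ z : ℤ_[p], z ^ 3 = u := by
  obtain ⟨t, rfl⟩ := ZMod.ringHom_surjective (PadicInt.toZMod (p := p)) τ
  refine exists_pow_three_eq (isUnit_iff_toZMod_ne_zero.2 hτ) ?_
  have h3 : ‖(3 : ℤ_[p])‖ = 1 := by
    have := PadicInt.norm_natCast_eq_one_iff (p := p) (n := 3)
    rw [Nat.cast_ofNat] at this
    exact this.2 ((Nat.coprime_primes Fact.out Nat.prime_three).2 hp)
  rw [h3, one_pow, ← PadicInt.mem_nonunits, mem_nonunits_iff, isUnit_iff_toZMod_ne_zero]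
  simp [h]

theorem exists_pow_three_eq_of_mod_nine [Fact (Nat.Prime 3)] {u s : ℤ_[3]} (hs : s = 1 ∨ s = -1)
    (h : PadicInt.toZModPow 2 u = PadicInt.toZModPow 2 s) : ∃ z : ℤ_[3], z ^ 3 = u := by
  have h1 : u - s ∈ RingHom.ker (PadicInt.toZModPow (p := 3) 2) := by
    rw [RingHom.mem_ker, map_sub, h, sub_self]
  rw [PadicInt.ker_toZModPow, Ideal.mem_span_singleton] at h1
  obtain ⟨k, hk⟩ := h1
  have hs2 : s ^ 2 = 1 := by rcases hs with rfl | rfl <;> norm_num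
  have hn3 : ‖(3 : ℤ_[3])‖ = (3 : ℝ)⁻¹ := by
    simpa using PadicInt.norm_p (p := 3)
  have hu : u - (s + 3 * k) ^ 3 = 3 ^ 3 * -(s * k ^ 2 + k ^ 3) := by
    push_cast at hk
    linear_combination hk - (s + 9 * k) * hs2
  -- With `u = s + 9 * k`, the approximation `s` has error of norm at most `1/9`, which is not
  -- enough for Hensel. The correction `3 * k` cancels the term `9 * k` and leaves an error
  -- divisible by `27`.
  refine exists_pow_three_eq (t := s + 3 * k) ?_ ?_
  · rw [isUnit_iff_toZMod_ne_zero]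
    have h30 : PadicInt.toZMod (3 : ℤ_[3]) = 0 := by
      rw [map_ofNat]; rfl
    rw [map_add, map_mul, h30, zero_mul, add_zero]
    rcases hs with rfl | rfl <;> simp
  · rw [hu, norm_mul, norm_pow, hn3]
    have := PadicInt.norm_le_one (-(s * k ^ 2 + k ^ 3))
    norm_num at this ⊢
    linarith

/-! ### The density as a polynomial in `p⁻¹`. -/

/-- The number of sets of `m` classes satisfying `D` whose levels add up to `w`. -/
def levelCount {J : Type*} [Fintype J] [DecidableEq J] (D : Finset (Fin 3 × J) → Prop)
    [DecidablePred D] (m w : ℕ) : ℕ :=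
  ((Finset.powersetCard m Finset.univ).filter
    fun S : Finset (Fin 3 × J) => D S ∧ ∑ c ∈ S, (c.1 : ℕ) = w).card

/-- The density as a polynomial in `p⁻¹` whose coefficients count insoluble sets of classes. -/
theorem rho_eq_levelCount {p : ℕ} [Fact p.Prime] {J : Type*} [Fintype J] [DecidableEq J]
    {e : J → ℤ_[p]} (he : ∀ j, IsUnit (e j))
    (hcov : ∀ u : ℤ_[p], IsUnit u → ∃ j x, u = e j * x ^ 3)
    (D : Finset (Fin 3 × J) → Prop) [DecidablePred D]
    (hD : ∀ S, D S ↔ ¬ HasZeroOn 3 (levelRep e) S) (hpair : ∀ c d, c ≠ d → D {c, d}) (n : ℕ) :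
    rho p n 3 = 1 - (n + 1).factorial *
      (∑ w : Fin (2 * (n + 1) + 1), levelCount D (n + 1) w * (p : ℝ)⁻¹ ^ (w : ℕ)) /
        (Fintype.card J * (1 + (p : ℝ)⁻¹ + (p : ℝ)⁻¹ ^ 2)) ^ (n + 1) := by
  have hT : ∑ c, ‖levelRep e c‖ = Fintype.card J * (1 + (p : ℝ)⁻¹ + (p : ℝ)⁻¹ ^ 2) := by
    simp only [norm_levelRep he, Fintype.sum_prod_type, Fin.sum_univ_three, Finset.sum_const,
      Finset.card_univ, nsmul_eq_mul, Fin.val_zero, Fin.val_one, Fin.val_two, pow_zero, pow_one]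
    ring
  rw [rho_eq (by decide) (levelRep e) (levelRep_ne_zero he) (exists_mem_powerClass_levelRep hcov) D
    hD hpair n, mul_div_assoc]
  congr 2
  -- Sets are grouped by total level, which is at most `2 * (n + 1)` as each of the `n + 1` levels
  -- is at most 2.
  rw [hT, Finset.sum_div,
    ← Finset.sum_fiberwise_of_maps_to (g := fun S : Finset (Fin 3 × J) => ∑ c ∈ S, (c.1 : ℕ))
      (t := Finset.range (2 * (n + 1) + 1)), ← Fin.sum_univ_eq_sum_range]
  · refine Finset.sum_congr rfl fun w _ => ?_
    rw [levelCount, mul_div_assoc, Finset.filter_filter, ← nsmul_eq_mul (Finset.card _), ← Finset.sum_const]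
    refine Finset.sum_congr rfl fun S hS => ?_
    rw [Finset.mem_filter, Finset.mem_powersetCard] at hS
    simp only [norm_levelRep he, Finset.prod_div_distrib, Finset.prod_const, hS.1.2,
      Finset.prod_pow_eq_pow_sum, hS.2.2]
  · intro S hS
    rw [Finset.mem_filter, Finset.mem_powersetCard] at hS
    rw [Finset.mem_range, Nat.lt_succ_iff, mul_comm, ← hS.1.2]
    exact Finset.sum_le_card_nsmul S _ 2 fun c _ => Nat.lt_succ_iff.1 c.1.2

theorem rho_eq_one {p : ℕ} [Fact p.Prime] {J : Type*} [Fintype J] [DecidableEq J]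
    {e : J → ℤ_[p]} (he : ∀ j, IsUnit (e j))
    (hcov : ∀ u : ℤ_[p], IsUnit u → ∃ j x, u = e j * x ^ 3)
    (D : Finset (Fin 3 × J) → Prop) [DecidablePred D]
    (hD : ∀ S, D S ↔ ¬ HasZeroOn 3 (levelRep e) S) (hpair : ∀ c d, c ≠ d → D {c, d}) {n : ℕ}
    (hn : ∀ S, D S → S.card ≤ n) : rho p n 3 = 1 := by
  rw [rho_eq (by decide) (levelRep e) (levelRep_ne_zero he) (exists_mem_powerClass_levelRep hcov) D
    hD hpair n, Finset.filter_eq_empty_iff.2, Finset.sum_empty, mul_zero, sub_zero]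
  intro S hS h
  have := hn S h
  rw [Finset.mem_powersetCard] at hS
  omega

/-! ### `p ≡ 2 mod 3` -/

theorem exists_pow_three_eq_of_mod_two {p : ℕ} [Fact p.Prime] (hp : p % 3 = 2) {u : ℤ_[p]}
    (hu : IsUnit u) : ∃ z, z ^ 3 = u := by
  rw [isUnit_iff_toZMod_ne_zero] at hu
  -- The exponent inverts `3` modulo `p - 1`: three times it is `2 * (p - 1) + 1`.
  refine exists_pow_three_eq_of_toZMod (τ := PadicInt.toZMod u ^ (2 * (p / 3) + 1)) (by omega)
    (pow_ne_zero _ hu) ?_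
  rw [← pow_mul, show (2 * (p / 3) + 1) * 3 = (p - 1) * 2 + 1 by omega, pow_succ, pow_mul,
    ZMod.pow_card_sub_one_eq_one hu, one_pow, one_mul]

/-- With one class per level, a normalized zero reduces modulo `p` to the cube of a unit being zero.
-/
theorem not_hasZeroOn_of_mod_two {p : ℕ} [Fact p.Prime] (S : Finset (Fin 3 × Fin 1)) :
    ¬ HasZeroOn 3 (levelRep fun _ : Fin 1 => (1 : ℤ_[p])) S := by
  rw [hasZeroOn_levelRep_iff fun _ => isUnit_one]
  rintro ⟨r, y, -, ⟨j, hj⟩, hs⟩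
  rw [Subsingleton.elim j 0, isUnit_iff_toZMod_ne_zero] at hj
  have h := congrArg PadicInt.toZMod hs
  simp [Fin.sum_univ_three] at h
  exact hj h

/-! ### `p ≡ 1 mod 3` -/

/-- A primitive root modulo `p` represents the generator of the cubic residue classes. -/
theorem exists_cubic_nonresidue {p : ℕ} [Fact p.Prime] (hp : p % 3 = 1) :
    ∃ γ : ZMod p, γ ≠ 0 ∧ (∀ t, t ^ 3 ≠ γ ^ 2) ∧
      ∀ u, u ≠ 0 → ∃ (j : Fin 3) (t : ZMod p), t ≠ 0 ∧ u = γ ^ (j : ℕ) * t ^ 3 := by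
  obtain ⟨ζ, hζ⟩ := IsCyclic.exists_generator (α := (ZMod p)ˣ)
  have hp1 := (Fact.out : p.Prime).one_lt
  have hord : orderOf ζ = p - 1 := by
    rw [orderOf_eq_card_of_forall_mem_zpowers hζ, Nat.card_eq_fintype_card,
      ZMod.card_units_eq_totient, Nat.totient_prime Fact.out]
  refine ⟨ζ, ζ.ne_zero, fun t ht => ?_, fun u hu => ?_⟩
  · have ht0 : t ≠ 0 := by
      rintro rfl
      exact pow_ne_zero 2 ζ.ne_zero (by rw [← ht]; simp)
    have h1 : ζ ^ (2 * (p / 3)) = 1 := by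
      apply Units.ext
      rw [Units.val_pow_eq_pow_val, pow_mul, ← ht, ← pow_mul,
        show 3 * (p / 3) = p - 1 by omega, ZMod.pow_card_sub_one_eq_one ht0, Units.val_one]
    -- The exponent `2 * (p / 3)` is positive but smaller than the order `p - 1` of `ζ`.
    have h2 := Nat.le_of_dvd (by omega) (hord ▸ orderOf_dvd_of_pow_eq_one h1)
    omega
  · obtain ⟨k, hk⟩ := mem_powers_iff_mem_zpowers.2 (hζ (Units.mk0 u hu))
    have hk' : u = (ζ : ZMod p) ^ k := by
      rw [← Units.val_pow_eq_pow_val]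
      exact (congrArg Units.val hk).symm
    refine ⟨⟨k % 3, Nat.mod_lt _ (by norm_num)⟩, (ζ : ZMod p) ^ (k / 3),
      pow_ne_zero _ ζ.ne_zero, ?_⟩
    rw [hk', ← pow_mul, ← pow_add]
    congr 1
    simp only
    omega

/-- The cubic `x³ + γ y³ + γ² z³` has a zero with `x ≠ 0` over a finite field in which `γ`
generates the cubic residue classes. -/
theorem exists_diagonal_cubic_zero {F : Type*} [Field F] [Finite F] {γ : F}
    (hγ : ∀ t, t ^ 3 ≠ γ ^ 2)
    (hcov : ∀ u : F, u ≠ 0 → ∃ (j : Fin 3) (t : F), t ≠ 0 ∧ u = γ ^ (j : ℕ) * t ^ 3) :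
    ∃ x y z : F, x ≠ 0 ∧ x ^ 3 + γ * y ^ 3 + γ ^ 2 * z ^ 3 = 0 := by
  classical
  have hγ0 : γ ≠ 0 := by
    rintro rfl
    exact hγ 0 (by simp)
  by_contra! hno
  let H := {x : F // ∃ t, t ≠ 0 ∧ t ^ 3 = x}
  have hH0 (x : H) : (x : F) ≠ 0 := by
    obtain ⟨_, t, ht, rfl⟩ := x
    exact pow_ne_zero 3 ht
  have hneg (x : F) (hx : ∃ t, t ≠ 0 ∧ t ^ 3 = x) : ∃ t, t ≠ 0 ∧ t ^ 3 = -x := by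
    obtain ⟨t, ht, rfl⟩ := hx
    exact ⟨-t, neg_ne_zero.2 ht, by ring⟩
  have hsum (x y : H) (h : ¬ ∃ t, t ≠ 0 ∧ t ^ 3 = (x : F) + γ * y) :
      ∃ t, t ≠ 0 ∧ t ^ 3 = γ⁻¹ * ((x : F) + γ * y) := by
    obtain ⟨_, s, hs, rfl⟩ := x
    obtain ⟨_, t, ht, rfl⟩ := y
    simp only at h ⊢
    have hne : s ^ 3 + γ * t ^ 3 ≠ 0 := by
      have := hno s t 0 hs
      simpa using this
    obtain ⟨j, v, hv, hj⟩ := hcov _ hne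
    fin_cases j
    · exact absurd ⟨v, hv, by simpa using hj.symm⟩ h
    · refine ⟨v, hv, ?_⟩
      rw [hj]
      simp [hγ0]
    · refine absurd ?_ (hno s t (-v) hs)
      simp only at hj
      linear_combination hj
  -- For nonzero cubes `x, y`, the assumption puts `x + γ y` in `H` or `γ H`. According to the case,
  -- `f` sends `(x, y)` to `(x, -(x + γ y))` or `(y, -γ⁻¹ (x + γ y))`. Equal values from different
  -- cases would make `γ²` a ratio of cubes, so `f` is injective.
  let f : H × H → H × H := fun q =>
    if h : ∃ t, t ≠ 0 ∧ t ^ 3 = (q.1 : F) + γ * q.2 then (q.1, ⟨_, hneg _ h⟩)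
    else (q.2, ⟨_, hneg _ (hsum q.1 q.2 h)⟩)
  have hf (q : H × H) : ((f q).1 = q.1 ∧ ((f q).2 : F) = -((q.1 : F) + γ * q.2)) ∨
      ((f q).1 = q.2 ∧ ((f q).2 : F) = -(γ⁻¹ * ((q.1 : F) + γ * q.2))) := by
    by_cases h : ∃ t, t ≠ 0 ∧ t ^ 3 = (q.1 : F) + γ * q.2
    · exact Or.inl (by simp [f, h])
    · exact Or.inr (by simp only [f, h, dite_false]; simp)
  have hne (x y : H) : (x : F) ≠ γ ^ 2 * y := by
    obtain ⟨_, s, hs, rfl⟩ := x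
    obtain ⟨_, t, ht, rfl⟩ := y
    intro h
    refine hγ (s / t) ?_
    rw [div_pow]
    field_simp
    simpa [mul_comm] using h
  have hinj : Function.Injective f := by
    rintro ⟨x, y⟩ ⟨x', y'⟩ h
    have h1 := hf (x, y)
    have h2 := hf (x', y')
    rw [h] at h1
    generalize f (x', y') = q at h1 h2
    obtain ⟨q1, q2⟩ := q
    simp only at h1 h2
    rcases h1 with ⟨rfl, h1⟩ | ⟨rfl, h1⟩ <;> rcases h2 with ⟨rfl, h2⟩ | ⟨rfl, h2⟩
    · rw [h1] at h2
      have : y = y' := Subtype.ext (mul_left_cancel₀ hγ0 (by linear_combination -h2))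
      rw [this]
    · rw [h1] at h2
      field_simp at h2
      exact absurd (by linear_combination h2) (hne x' y)
    · rw [h1] at h2
      field_simp at h2
      exact absurd (by linear_combination -h2) (hne x y')
    · rw [h1] at h2
      field_simp at h2
      have : x = x' := Subtype.ext (by linear_combination -h2)
      rw [this]
  -- By finiteness `f` is onto, yet `(1, -1)` has no preimage: it would force `γ y = 0` in the first
  -- case and `x = 0` in the second.
  obtain ⟨q, hq⟩ := (Finite.injective_iff_surjective.1 hinj)
    (⟨1, 1, one_ne_zero, one_pow 3⟩, ⟨-1, -1, neg_ne_zero.2 one_ne_zero, by norm_num⟩)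
  have h := hf q
  rw [hq] at h
  rcases h with ⟨h1, h2⟩ | ⟨h1, h2⟩
  · have h1 := congrArg Subtype.val h1
    simp only at h1 h2
    exact mul_ne_zero hγ0 (hH0 q.2) (by linear_combination h1 + h2)
  · have h1 := congrArg Subtype.val h1
    simp only at h1 h2
    field_simp at h2
    exact hH0 q.1 (by linear_combination h2 + γ * h1)

/-- For `p ≡ 1 mod 3` a set of classes is insoluble iff it contains no full level. -/
abbrev NoFullLevel (S : Finset (Fin 3 × Fin 3)) : Prop := ∀ r, ∃ j, (r, j) ∉ S

/-- A nontrivial zero with only two terms would make `γ` or `γ²` a cube up to sign; either way `γ²`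
would be a cube. -/
theorem eq_zero_of_two_term_cubic {F : Type*} [Field F] {γ : F} (hγ : ∀ t, t ^ 3 ≠ γ ^ 2)
    {Y : Fin 3 → F} {j : Fin 3} (hj : Y j = 0) (h : ∑ j : Fin 3, γ ^ (j : ℕ) * Y j ^ 3 = 0) : Y = 0 := by
  have hγ0 : γ ≠ 0 := by
    rintro rfl
    exact hγ 0 (by simp)
  have h1 (x y : F) (hxy : x ^ 3 + γ * y ^ 3 = 0) : x = 0 ∧ y = 0 := by
    have hy : y = 0 := by
      by_contra hy
      refine hγ ((x / y) ^ 2) ?_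
      field_simp
      linear_combination (x ^ 3 - γ * y ^ 3) * hxy
    refine ⟨?_, hy⟩
    rw [hy] at hxy
    simpa using hxy
  have h2 (x y : F) (hxy : x ^ 3 + γ ^ 2 * y ^ 3 = 0) : x = 0 ∧ y = 0 := by
    have hy : y = 0 := by
      by_contra hy
      refine hγ (-x / y) ?_
      field_simp
      linear_combination -hxy
    refine ⟨?_, hy⟩
    rw [hy] at hxy
    simpa using hxy
  simp only [Fin.sum_univ_three, Fin.val_zero, Fin.val_one, Fin.val_two] at h
  have hall : Y 0 = 0 ∧ Y 1 = 0 ∧ Y 2 = 0 := by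
    fin_cases j <;> simp only [Fin.zero_eta, Fin.mk_one, Fin.reduceFinMk] at hj <;> rw [hj] at h
    · have := h1 (Y 1) (Y 2) (mul_left_cancel₀ hγ0 (by linear_combination h))
      exact ⟨hj, this⟩
    · have := h2 (Y 0) (Y 2) (by linear_combination h)
      exact ⟨this.1, hj, this.2⟩
    · have := h1 (Y 0) (Y 1) (by linear_combination h)
      exact ⟨this.1, this.2, hj⟩
  ext i
  fin_cases i
  exacts [hall.1, hall.2.1, hall.2.2]

/-- Modulo `p` only level `0` of a normalized zero survives, and it vanishes if a class is missing
there. Conversely, a full level carries a zero modulo `p`, whose first coordinate is nonzero and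
lifts by Hensel. -/
theorem noFullLevel_iff {p : ℕ} [Fact p.Prime] (hp : p ≠ 3) {g : ℤ_[p]} (hg : IsUnit g)
    (hγ : ∀ t, t ^ 3 ≠ PadicInt.toZMod g ^ 2)
    (hcov : ∀ u : ZMod p, u ≠ 0 →
      ∃ (j : Fin 3) (t : ZMod p), t ≠ 0 ∧ u = PadicInt.toZMod g ^ (j : ℕ) * t ^ 3)
    (S : Finset (Fin 3 × Fin 3)) :
    NoFullLevel S ↔ ¬ HasZeroOn 3 (levelRep fun j : Fin 3 => g ^ (j : ℕ)) S := by
  rw [hasZeroOn_levelRep_iff fun j => hg.pow _]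
  constructor
  · rintro h ⟨r, y, hyS, ⟨j, hj⟩, hs⟩
    obtain ⟨i, hi⟩ := h r
    have h1 := congrArg PadicInt.toZMod hs
    rw [Fin.sum_univ_three] at h1
    simp only [map_add, map_mul, map_pow, map_sum, map_natCast, CharP.cast_eq_zero, Fin.val_zero,
      Fin.val_one, Fin.val_two, pow_zero, pow_one, one_mul, zero_mul, add_zero, map_zero,
      ne_eq, OfNat.ofNat_ne_zero, not_false_eq_true, zero_pow] at h1
    have h2 := eq_zero_of_two_term_cubic hγ (Y := fun j => PadicInt.toZMod (y 0 j)) (j := i)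
      (by simp [hyS 0 i (by simpa using hi)]) h1
    exact isUnit_iff_toZMod_ne_zero.1 hj (congrFun h2 j)
  · contrapose!
    intro h
    simp only [NoFullLevel, not_forall, not_exists, not_not] at h
    obtain ⟨r, hr⟩ := h
    obtain ⟨x, y, z, hx, hxyz⟩ := exists_diagonal_cubic_zero hγ hcov
    obtain ⟨y, rfl⟩ := ZMod.ringHom_surjective (PadicInt.toZMod (p := p)) y
    obtain ⟨z, rfl⟩ := ZMod.ringHom_surjective (PadicInt.toZMod (p := p)) z
    obtain ⟨w, hw⟩ := exists_pow_three_eq_of_toZMod (u := -(g * y ^ 3 + g ^ 2 * z ^ 3)) hp hx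
      (by simp only [map_neg, map_add, map_mul, map_pow]; linear_combination -hxyz)
    have hwx : PadicInt.toZMod w ≠ 0 := by
      intro h0
      have h1 := congrArg PadicInt.toZMod hw
      simp only [map_neg, map_add, map_mul, map_pow, h0] at h1
      exact pow_ne_zero 3 hx (by linear_combination hxyz - h1)
    refine ⟨r, ![![w, y, z], 0, 0], ?_, ⟨0, isUnit_iff_toZMod_ne_zero.2 hwx⟩, ?_⟩
    · intro i j hij
      fin_cases i
      · exact absurd (hr j) (by simpa using hij)
      · rfl
      · rfl
    · simp only [Fin.sum_univ_three]
      simp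
      linear_combination hw

/-! ### `p = 3` -/

/-- For `p = 3` a set of classes is insoluble iff no level with at least two elements is followed
(cyclically) by a nonempty level. -/
abbrev NoPairBeforeLevel (S : Finset (Fin 3 × Fin 3)) : Prop :=
  ∀ r j j', j ≠ j' → (r, j) ∈ S → (r, j') ∈ S → ∀ b, (r + 1, b) ∉ S

theorem two_ne_zero_zmod_three : (2 : ZMod 3) ≠ 0 := by decide

theorem isUnit_two_padicInt_three [Fact (Nat.Prime 3)] : IsUnit (2 : ℤ_[3]) := by
  rw [isUnit_iff_toZMod_ne_zero, map_ofNat]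
  exact two_ne_zero_zmod_three

/-- The group of units modulo `9` is generated by `2`, with `2 ^ 3 = -1`, and a unit that is `±1`
modulo `9` is a cube. -/
theorem exists_eq_two_pow_mul_cube [Fact (Nat.Prime 3)] {u : ℤ_[3]} (hu : IsUnit u) :
    ∃ (j : Fin 3) (x : ℤ_[3]), u = 2 ^ (j : ℕ) * x ^ 3 := by
  have key : ∀ w v : ZMod (3 ^ 2), w * v = 1 →
      ∃ (j : Fin 3) (s : Fin 2), w = 2 ^ (j : ℕ) * (-1) ^ (s : ℕ) := by decide +kernel
  obtain ⟨v, hv⟩ := hu.exists_right_inv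
  obtain ⟨j, s, hjs⟩ := key (PadicInt.toZModPow 2 u) (PadicInt.toZModPow 2 v)
    (by rw [← map_mul, hv, map_one])
  obtain ⟨d, hd⟩ := (isUnit_two_padicInt_three.pow (j : ℕ)).exists_right_inv
  obtain ⟨z, hz⟩ := exists_pow_three_eq_of_mod_nine (u := u * d) (neg_one_pow_eq_or ℤ_[3] (s : ℕ)) (by
    have h := congrArg (PadicInt.toZModPow 2) hd
    simp only [map_mul, map_pow, map_ofNat, map_neg, map_one] at h ⊢
    rw [hjs]
    linear_combination (-1) ^ (s : ℕ) * h)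
  exact ⟨j, z, by rw [hz]; linear_combination -u * hd⟩

/-- Modulo `9` a normalized zero involves level `0` plus three times level `1`. A lone unit term in
level `0` is already nonzero modulo `3`, and level `0` by itself is anisotropic modulo `9`; with two
terms and one from the next level, signs can be chosen to cancel. -/
theorem noPairBeforeLevel_iff [Fact (Nat.Prime 3)] (S : Finset (Fin 3 × Fin 3)) :
    NoPairBeforeLevel S ↔ ¬ HasZeroOn 3 (levelRep fun j : Fin 3 => (2 : ℤ_[3]) ^ (j : ℕ)) S := by
  rw [hasZeroOn_levelRep_iff fun j => isUnit_two_padicInt_three.pow _]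
  constructor
  · rintro h ⟨r, y, hyS, ⟨j, hj⟩, hs⟩
    have hne : PadicInt.toZModPow 2 (y 0 j) ^ 3 ≠ 0 := by
      have : Nontrivial (ZMod (3 ^ 2)) := ⟨0, 1, by decide⟩
      exact ((hj.map (PadicInt.toZModPow 2)).pow 3).ne_zero
    have h1 := congrArg (PadicInt.toZModPow 2) hs
    simp only [Fin.sum_univ_three, map_add, map_mul, map_pow, map_ofNat, map_zero, Fin.val_zero,
      Fin.val_one, Fin.val_two, pow_zero, pow_one, one_mul, Nat.cast_ofNat] at h1
    have h9 : (3 : ZMod (3 ^ 2)) ^ 2 = 0 := by decide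
    rw [h9, zero_mul, add_zero] at h1
    by_cases hpair : ∃ j j' : Fin 3, j ≠ j' ∧ (r, j) ∈ S ∧ (r, j') ∈ S
    · obtain ⟨i, i', hne', hi, hi'⟩ := hpair
      have h0 (b : Fin 3) : y 1 b = 0 := hyS 1 b (h r i i' hne' hi hi' b)
      simp only [h0, map_zero, ne_eq, OfNat.ofNat_ne_zero, not_false_eq_true, zero_pow, mul_zero,
        add_zero] at h1
      -- Cubes modulo `9` are `0, ±1`, and a nonempty signed sum of distinct elements of `{1, 2, 4}`
      -- is nonzero with absolute value at most 7.
      have key : ∀ a b c : ZMod (3 ^ 2), a ^ 3 + 2 * b ^ 3 + 2 ^ 2 * c ^ 3 = 0 →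
          a ^ 3 = 0 ∧ b ^ 3 = 0 ∧ c ^ 3 = 0 := by decide +kernel
      have := key _ _ _ h1
      fin_cases j
      exacts [hne this.1, hne this.2.1, hne this.2.2]
    · have h0 (i : Fin 3) (hi : i ≠ j) : y 0 i = 0 := by
        refine hyS 0 i fun hiS => hpair ⟨i, j, hi, by simpa using hiS, ?_⟩
        by_contra hjS
        rw [hyS 0 j (by simpa using hjS)] at hj
        exact not_isUnit_zero hj
      -- Multiplying by `3` removes level `1` modulo `9`, leaving the single unit term.
      have h3 : 3 * (2 ^ (j : ℕ) * PadicInt.toZModPow 2 (y 0 j) ^ 3) = 0 := by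
        fin_cases j <;>
          simp only [Fin.zero_eta, Fin.mk_one, Fin.reduceFinMk] at h0 hne ⊢
        · rw [h0 1 (by decide), h0 2 (by decide), map_zero] at h1
          linear_combination 3 * h1 - (PadicInt.toZModPow 2 (y 1 0) ^ 3 +
            2 * PadicInt.toZModPow 2 (y 1 1) ^ 3 + 2 ^ 2 * PadicInt.toZModPow 2 (y 1 2) ^ 3) * h9
        · rw [h0 0 (by decide), h0 2 (by decide), map_zero] at h1
          linear_combination 3 * h1 - (PadicInt.toZModPow 2 (y 1 0) ^ 3 +
            2 * PadicInt.toZModPow 2 (y 1 1) ^ 3 + 2 ^ 2 * PadicInt.toZModPow 2 (y 1 2) ^ 3) * h9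
        · rw [h0 0 (by decide), h0 1 (by decide), map_zero] at h1
          linear_combination 3 * h1 - (PadicInt.toZModPow 2 (y 1 0) ^ 3 +
            2 * PadicInt.toZModPow 2 (y 1 1) ^ 3 + 2 ^ 2 * PadicInt.toZModPow 2 (y 1 2) ^ 3) * h9
      have key : ∀ (j : Fin 3) (a : ZMod (3 ^ 2)), 3 * (2 ^ (j : ℕ) * a ^ 3) = 0 → a ^ 3 = 0 := by
        decide +kernel
      exact hne (key _ _ h3)
  · contrapose!
    intro h
    simp only [NoPairBeforeLevel, not_forall, not_not] at h
    obtain ⟨r, j, j', hne, hj, hj', b, hb⟩ := h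
    -- Two distinct elements of `{1, 2, 4}` have a signed sum `±3` modulo `9`, and `3 * 2 ^ b` is
    -- `±3` modulo `9`. The coordinate at `j` is then adjusted by Hensel to give an exact zero.
    have key : ∀ j j' b : Fin 3, j ≠ j' → ∃ s t u : Fin 2, (2 : ZMod (3 ^ 2)) ^ (j : ℕ) *
        (-1) ^ (s : ℕ) + 2 ^ (j' : ℕ) * (-1) ^ (t : ℕ) + 3 * (2 ^ (b : ℕ) * (-1) ^ (u : ℕ)) = 0 := by
      decide +kernel
    obtain ⟨s, t, u, hstu⟩ := key j j' b hne
    have hcube (k : ℕ) : ((-1 : ℤ_[3]) ^ k) ^ 3 = (-1) ^ k := by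
      rcases neg_one_pow_eq_or ℤ_[3] k with h | h <;> rw [h] <;> norm_num
    obtain ⟨d, hd⟩ := (isUnit_two_padicInt_three.pow (j : ℕ)).exists_right_inv
    have hmod : PadicInt.toZModPow 2
        (-(2 ^ (j' : ℕ) * (-1) ^ (t : ℕ) + 3 * (2 ^ (b : ℕ) * (-1) ^ (u : ℕ))) * d : ℤ_[3]) =
          PadicInt.toZModPow 2 ((-1) ^ (s : ℕ)) := by
      have h := congrArg (PadicInt.toZModPow 2) hd
      simp only [map_add, map_mul, map_pow, map_ofNat, map_neg, map_one] at h ⊢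
      linear_combination (-1) ^ (s : ℕ) * h - PadicInt.toZModPow 2 d * hstu
    obtain ⟨z, hz⟩ := exists_pow_three_eq_of_mod_nine (neg_one_pow_eq_or ℤ_[3] (s : ℕ)) hmod
    have hzu : IsUnit (z ^ 3) := by
      rw [hz, isUnit_iff_toZMod_ne_zero]
      have h3 : (3 : ZMod 3) = 0 := by exact_mod_cast ZMod.natCast_self 3
      have hd0 : PadicInt.toZMod d ≠ 0 :=
        isUnit_iff_toZMod_ne_zero.1 (IsUnit.of_mul_eq_one_right _ hd)
      simp only [map_add, map_mul, map_pow, map_ofNat, map_neg, map_one, h3, zero_mul, add_zero]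
      exact mul_ne_zero (neg_ne_zero.2 (mul_ne_zero (pow_ne_zero _ two_ne_zero_zmod_three)
        (pow_ne_zero _ (neg_ne_zero.2 one_ne_zero)))) hd0
    refine ⟨r, ![Pi.single j z + Pi.single j' ((-1) ^ (t : ℕ)), Pi.single b ((-1) ^ (u : ℕ)), 0],
      ?_, ⟨j, ?_⟩, ?_⟩
    · intro i k hik
      fin_cases i
      · have h1 : k ≠ j := by rintro rfl; exact hik (by simpa using hj)
        have h2 : k ≠ j' := by rintro rfl; exact hik (by simpa using hj')
        simp [h1, h2]
      · have h1 : k ≠ b := by rintro rfl; exact hik hb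
        simp [h1]
      · rfl
    · simpa [hne] using (isUnit_pow_iff three_ne_zero).1 hzu
    · have hs0 : ∑ k : Fin 3, (2 : ℤ_[3]) ^ (k : ℕ) *
          (Pi.single j z + Pi.single j' ((-1) ^ (t : ℕ)) : Fin 3 → ℤ_[3]) k ^ 3 =
            2 ^ (j : ℕ) * z ^ 3 + 2 ^ (j' : ℕ) * (-1) ^ (t : ℕ) := by
        rw [Finset.sum_eq_add_of_mem j j' (Finset.mem_univ _) (Finset.mem_univ _) hne]
        · simp [hne, hne.symm, hcube]
        · rintro k - ⟨h1, h2⟩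
          simp [h1, h2]
      have hs1 : ∑ k : Fin 3, (2 : ℤ_[3]) ^ (k : ℕ) *
          (Pi.single b ((-1) ^ (u : ℕ)) : Fin 3 → ℤ_[3]) k ^ 3 = 2 ^ (b : ℕ) * (-1) ^ (u : ℕ) := by
        rw [Finset.sum_eq_single b]
        · simp [hcube]
        · intro k _ h1
          simp [h1]
        · simp
      rw [Fin.sum_univ_three]
      simp only [Matrix.cons_val, hs0, hs1, hz, Pi.zero_apply, ne_eq, OfNat.ofNat_ne_zero,
        not_false_eq_true, zero_pow, mul_zero, Finset.sum_const_zero, add_zero, Fin.val_zero,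
        Fin.val_one, pow_zero, pow_one, one_mul, Nat.cast_ofNat]
      linear_combination -(2 ^ (j' : ℕ) * (-1) ^ (t : ℕ) + 3 * (2 ^ (b : ℕ) * (-1) ^ (u : ℕ))) * hd

/-! ### Evaluation -/

theorem levelCount_true_three : ∀ w : Fin 7,
    levelCount (J := Fin 1) (fun _ => True) 3 w = ![0, 0, 0, 1, 0, 0, 0] w := by decide +kernel

/-- Each level contributes 0, 1 or 2 of its three classes, in 1, 3 or 3 ways. The counts for
`NoFullLevel` are thus the coefficients of `∏ (1 + 3 x^r t + 3 x^(2r) t²)` over `r = 0, 1, 2`. -/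
theorem levelCount_noFullLevel_three : ∀ w : Fin 7,
    levelCount NoFullLevel 3 w = ![0, 9, 18, 27, 18, 9, 0] w := by decide +kernel

theorem levelCount_noFullLevel_four : ∀ w : Fin 9,
    levelCount NoFullLevel 4 w = ![0, 0, 9, 27, 36, 27, 9, 0, 0] w := by decide +kernel

theorem levelCount_noFullLevel_five : ∀ w : Fin 11,
    levelCount NoFullLevel 5 w = ![0, 0, 0, 0, 27, 27, 27, 0, 0, 0, 0] w := by decide +kernel

theorem levelCount_noFullLevel_six : ∀ w : Fin 13,
    levelCount NoFullLevel 6 w = ![0, 0, 0, 0, 0, 0, 27, 0, 0, 0, 0, 0, 0] w := by decide +kernel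

theorem levelCount_noPairBeforeLevel_three : ∀ w : Fin 7,
    levelCount NoPairBeforeLevel 3 w = ![1, 0, 18, 28, 0, 9, 1] w := by decide +kernel

/-- The insoluble sets of size four are a full level together with one class of the level cyclically
before it. -/
theorem levelCount_noPairBeforeLevel_four : ∀ w : Fin 9,
    levelCount NoPairBeforeLevel 4 w = ![0, 0, 3, 3, 0, 0, 0, 3, 0] w := by decide +kernel

theorem noFullLevel_pair : ∀ c d, c ≠ d → NoFullLevel {c, d} := by decide +kernel

theorem noPairBeforeLevel_pair (c d : Fin 3 × Fin 3) : NoPairBeforeLevel {c, d} := by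
  have hr : ∀ r : Fin 3, r + 1 ≠ r := by decide
  intro r j j' hj h1 h2 b h3
  simp only [Finset.mem_insert, Finset.mem_singleton] at h1 h2 h3
  grind

theorem card_le_of_noFullLevel : ∀ S, NoFullLevel S → S.card ≤ 6 := by decide +kernel

theorem card_le_of_noPairBeforeLevel : ∀ S, NoPairBeforeLevel S → S.card ≤ 4 := by decide +kernel

/-! ### The density in each residue class of `p` modulo 3. -/

section
variable {p : ℕ} [Fact p.Prime]

theorem one_sub_inv_div_one_sub_inv_pow_three :
    (1 - (p : ℝ)⁻¹) / (1 - (p : ℝ)⁻¹ ^ 3) = 1 / (1 + (p : ℝ)⁻¹ + (p : ℝ)⁻¹ ^ 2) := by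
  have hp : (1 : ℝ) < p := by exact_mod_cast (Fact.out : p.Prime).one_lt
  have h0 : 0 < (p : ℝ)⁻¹ := by positivity
  have h1 : (p : ℝ)⁻¹ < 1 := inv_lt_one_of_one_lt₀ hp
  have h2 : (p : ℝ)⁻¹ ^ 3 < 1 := pow_lt_one₀ h0.le h1 three_ne_zero
  rw [div_eq_div_iff (by linarith) (by positivity)]
  ring

/-- The density for `p ≡ 2 mod 3`, where the classes are represented by `1, p, p ^ 2`. -/
theorem rho_of_mod_two (hp : p % 3 = 2) (n : ℕ) :
    rho p n 3 = 1 - (n + 1).factorial *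
      (∑ w : Fin (2 * (n + 1) + 1),
        levelCount (J := Fin 1) (fun _ => True) (n + 1) w * (p : ℝ)⁻¹ ^ (w : ℕ)) /
          ((Fintype.card (Fin 1) : ℕ) * (1 + (p : ℝ)⁻¹ + (p : ℝ)⁻¹ ^ 2)) ^ (n + 1) :=
  rho_eq_levelCount (e := fun _ : Fin 1 => (1 : ℤ_[p])) (fun _ => isUnit_one)
    (fun _ hu => ⟨0, (exists_pow_three_eq_of_mod_two hp hu).imp fun _ h => by rw [h, one_mul]⟩)
    (fun _ => True) (fun S => iff_of_true trivial (not_hasZeroOn_of_mod_two S))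
    (fun _ _ _ => trivial) n

theorem rho_eq_one_of_mod_two (hp : p % 3 = 2) {n : ℕ} (hn : 3 ≤ n) : rho p n 3 = 1 :=
  rho_eq_one (e := fun _ : Fin 1 => (1 : ℤ_[p])) (fun _ => isUnit_one)
    (fun _ hu => ⟨0, (exists_pow_three_eq_of_mod_two hp hu).imp fun _ h => by rw [h, one_mul]⟩)
    (fun _ => True) (fun S => iff_of_true trivial (not_hasZeroOn_of_mod_two S))
    (fun _ _ _ => trivial) fun S _ => (Finset.card_le_univ S).trans hn

/-- For `p ≡ 1 mod 3` the classes are represented by `p ^ r * g ^ j` with `g` a primitive root. -/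
theorem exists_unit_classes_of_mod_one (hp : p % 3 = 1) :
    ∃ g : ℤ_[p], IsUnit g ∧
      (∀ u : ℤ_[p], IsUnit u → ∃ (j : Fin 3) (x : ℤ_[p]), u = g ^ (j : ℕ) * x ^ 3) ∧
      ∀ S, NoFullLevel S ↔ ¬ HasZeroOn 3 (levelRep fun j : Fin 3 => g ^ (j : ℕ)) S := by
  obtain ⟨γ, hγ0, hγ, hcov⟩ := exists_cubic_nonresidue hp
  obtain ⟨g, rfl⟩ := ZMod.ringHom_surjective (PadicInt.toZMod (p := p)) γ
  have hg : IsUnit g := isUnit_iff_toZMod_ne_zero.2 hγ0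
  refine ⟨g, hg, fun u hu => ?_, noFullLevel_iff (by omega) hg hγ hcov⟩
  obtain ⟨j, t, ht, h⟩ := hcov _ (isUnit_iff_toZMod_ne_zero.1 hu)
  obtain ⟨d, hd⟩ := (hg.pow (j : ℕ)).exists_right_inv
  obtain ⟨z, hz⟩ := exists_pow_three_eq_of_toZMod (u := u * d) (by omega) ht (by
    have h1 := congrArg PadicInt.toZMod hd
    simp only [map_mul, map_pow, map_one] at h1 ⊢
    rw [h]
    linear_combination t ^ 3 * h1)
  exact ⟨j, z, by rw [hz]; linear_combination -u * hd⟩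

theorem rho_of_mod_one (hp : p % 3 = 1) (n : ℕ) :
    rho p n 3 = 1 - (n + 1).factorial *
      (∑ w : Fin (2 * (n + 1) + 1), levelCount NoFullLevel (n + 1) w * (p : ℝ)⁻¹ ^ (w : ℕ)) /
        ((Fintype.card (Fin 3) : ℕ) * (1 + (p : ℝ)⁻¹ + (p : ℝ)⁻¹ ^ 2)) ^ (n + 1) := by
  obtain ⟨g, hg, hcov, hD⟩ := exists_unit_classes_of_mod_one hp
  exact rho_eq_levelCount (fun j => hg.pow _) hcov NoFullLevel hD noFullLevel_pair n

theorem rho_eq_one_of_mod_one (hp : p % 3 = 1) {n : ℕ} (hn : 6 ≤ n) : rho p n 3 = 1 := by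
  obtain ⟨g, hg, hcov, hD⟩ := exists_unit_classes_of_mod_one hp
  exact rho_eq_one (fun j => hg.pow _) hcov NoFullLevel hD noFullLevel_pair
    fun S hS => (card_le_of_noFullLevel S hS).trans hn

end

theorem rho_three [Fact (Nat.Prime 3)] (n : ℕ) :
    rho 3 n 3 = 1 - (n + 1).factorial *
      (∑ w : Fin (2 * (n + 1) + 1),
        levelCount NoPairBeforeLevel (n + 1) w * ((3 : ℕ) : ℝ)⁻¹ ^ (w : ℕ)) /
          ((Fintype.card (Fin 3) : ℕ) * (1 + ((3 : ℕ) : ℝ)⁻¹ + ((3 : ℕ) : ℝ)⁻¹ ^ 2)) ^ (n + 1) :=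
  rho_eq_levelCount (fun _ => isUnit_two_padicInt_three.pow _)
    (fun _ hu => exists_eq_two_pow_mul_cube hu) NoPairBeforeLevel noPairBeforeLevel_iff
    (fun c d _ => noPairBeforeLevel_pair c d) n

theorem rho_three_eq_one [Fact (Nat.Prime 3)] {n : ℕ} (hn : 4 ≤ n) : rho 3 n 3 = 1 :=
  rho_eq_one (fun _ => isUnit_two_padicInt_three.pow _)
    (fun _ hu => exists_eq_two_pow_mul_cube hu) NoPairBeforeLevel noPairBeforeLevel_iff
    (fun c d _ => noPairBeforeLevel_pair c d) fun S hS => (card_le_of_noPairBeforeLevel S hS).trans hn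

theorem theorem1p4 (p : ℕ) [Fact p.Prime] :
    -- n = 2
    ((p = 3 → rho p 2 3 = 13831 / 19773) ∧
      (p ≡ 1 [MOD 3] → rho p 2 3 =
        1 - 2 * (p : ℝ) ^ (-1 : ℤ) * ((1 - (p : ℝ) ^ (-1 : ℤ)) / (1 - (p : ℝ) ^ (-3 : ℤ)))) ∧
      (p ≡ 2 [MOD 3] → rho p 2 3 =
        1 - 6 * (p : ℝ) ^ (-3 : ℤ) *
          ((1 - (p : ℝ) ^ (-1 : ℤ)) / (1 - (p : ℝ) ^ (-3 : ℤ))) ^ 3)) ∧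
    -- n = 3
    ((p = 3 → rho p 3 3 = 6391 / 6591) ∧
      (p ≡ 1 [MOD 3] → rho p 3 3 =
        1 - 8 / 3 * (p : ℝ) ^ (-2 : ℤ) * (1 + (p : ℝ) ^ (-1 : ℤ)) ^ 2 *
          ((1 - (p : ℝ) ^ (-1 : ℤ)) / (1 - (p : ℝ) ^ (-3 : ℤ))) ^ 3) ∧
      (p ≡ 2 [MOD 3] → rho p 3 3 = 1)) ∧
    -- n = 4
    ((p ≡ 1 [MOD 3] → rho p 4 3 =
        1 - 40 / 3 * (p : ℝ) ^ (-4 : ℤ) *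
          ((1 - (p : ℝ) ^ (-1 : ℤ)) / (1 - (p : ℝ) ^ (-3 : ℤ))) ^ 4) ∧
      (¬ p ≡ 1 [MOD 3] → rho p 4 3 = 1)) ∧
    -- n = 5
    ((p ≡ 1 [MOD 3] → rho p 5 3 =
        1 - 80 / 3 * (p : ℝ) ^ (-6 : ℤ) *
          ((1 - (p : ℝ) ^ (-1 : ℤ)) / (1 - (p : ℝ) ^ (-3 : ℤ))) ^ 6) ∧
      (¬ p ≡ 1 [MOD 3] → rho p 5 3 = 1)) ∧
    -- n ≥ 6
    (∀ n : ℕ, 6 ≤ n → rho p n 3 = 1) := by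
  have hmod : p = 3 ∨ p % 3 = 1 ∨ p % 3 = 2 := by
    by_cases h3 : p % 3 = 0
    · exact Or.inl ((Nat.prime_dvd_prime_iff_eq Nat.prime_three Fact.out).1
        (Nat.dvd_of_mod_eq_zero h3)).symm
    · omega
  have hzpow (k : ℕ) : (p : ℝ) ^ (-(k : ℤ)) = (p : ℝ)⁻¹ ^ k := by
    rw [zpow_neg, zpow_natCast, inv_pow]
  have hz1 : (p : ℝ) ^ (-1 : ℤ) = (p : ℝ)⁻¹ := zpow_neg_one _
  have hz2 : (p : ℝ) ^ (-2 : ℤ) = (p : ℝ)⁻¹ ^ 2 := hzpow 2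
  have hz3 : (p : ℝ) ^ (-3 : ℤ) = (p : ℝ)⁻¹ ^ 3 := hzpow 3
  have hz4 : (p : ℝ) ^ (-4 : ℤ) = (p : ℝ)⁻¹ ^ 4 := hzpow 4
  have hz6 : (p : ℝ) ^ (-6 : ℤ) = (p : ℝ)⁻¹ ^ 6 := hzpow 6
  have hx : 0 < (p : ℝ)⁻¹ := by
    have := (Fact.out : p.Prime).pos
    positivity
  have hT : 1 + (p : ℝ)⁻¹ + (p : ℝ)⁻¹ ^ 2 ≠ 0 := by positivity
  have hnot {n : ℕ} (hn : 4 ≤ n) (h : ¬ p ≡ 1 [MOD 3]) : rho p n 3 = 1 := by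
    rcases hmod with rfl | h1 | h2
    · exact rho_three_eq_one hn
    · exact absurd h1 h
    · exact rho_eq_one_of_mod_two h2 (by omega)
  rw [hz1, hz2, hz3, hz4, hz6, one_sub_inv_div_one_sub_inv_pow_three]
  refine ⟨⟨?_, fun h => ?_, fun h => ?_⟩, ⟨?_, fun h => ?_, fun h => ?_⟩, ⟨fun h => ?_, ?_⟩,
    ⟨fun h => ?_, ?_⟩, fun n hn => ?_⟩
  · rintro rfl
    rw [rho_three, Finset.sum_congr rfl fun w _ => by rw [levelCount_noPairBeforeLevel_three]]
    simp [Fin.sum_univ_succ, Nat.factorial]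
    norm_num
  · rw [rho_of_mod_one h, Finset.sum_congr rfl fun w _ => by rw [levelCount_noFullLevel_three]]
    -- With the counts inserted, the claim is an identity of rational functions in `x = p⁻¹` with
    -- denominator a power of `1 + x + x²`.
    generalize (p : ℝ)⁻¹ = x at hT
    simp [Fin.sum_univ_succ, Nat.factorial]
    field_simp
    ring
  · rw [rho_of_mod_two h, Finset.sum_congr rfl fun w _ => by rw [levelCount_true_three]]
    generalize (p : ℝ)⁻¹ = x at hT
    simp [Fin.sum_univ_succ, Nat.factorial]
    field_simp
  · rintro rfl
    rw [rho_three, Finset.sum_congr rfl fun w _ => by rw [levelCount_noPairBeforeLevel_four]]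
    simp [Fin.sum_univ_succ, Nat.factorial]
    norm_num
  · rw [rho_of_mod_one h, Finset.sum_congr rfl fun w _ => by rw [levelCount_noFullLevel_four]]
    generalize (p : ℝ)⁻¹ = x at hT
    simp [Fin.sum_univ_succ, Nat.factorial]
    field_simp
    ring
  · exact rho_eq_one_of_mod_two h le_rfl
  · rw [rho_of_mod_one h, Finset.sum_congr rfl fun w _ => by rw [levelCount_noFullLevel_five]]
    generalize (p : ℝ)⁻¹ = x at hT
    simp [Fin.sum_univ_succ, Nat.factorial]
    field_simp
    ring
  · exact hnot le_rfl
  · rw [rho_of_mod_one h, Finset.sum_congr rfl fun w _ => by rw [levelCount_noFullLevel_six]]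
    generalize (p : ℝ)⁻¹ = x at hT
    simp [Fin.sum_univ_succ, Nat.factorial]
    field_simp
    ring
  · exact hnot (by norm_num)
  · by_cases h : p ≡ 1 [MOD 3]
    · exact rho_eq_one_of_mod_one h hn
    · exact hnot (by omega) h
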